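/- **Setting (random oracle model).** A linkable ring signature (LRS) scheme $S$ consists of algorithms $\mathsf{Init}(1^\lambda)$ (public parameters), $\mathsf{KeyGen}$ (a secret/public key pair, run by each user), deterministic algorithms $\mathsf{AccumulatePubKey}$ (a set of public keys to a value $v$) and $\mathsf{GeneratePubKeyWitness}$ (the other members' keys to a witness $w$), and $\mathsf{Sign}$, $\mathsf{Verify}$, $\mathsf{Link}$; $\mathsf{KeyGen},\mathsf{Sign},\mathsf{Verify}$ may use a random oracle. Write $E$ for the set of $n=n(\lambda)$ endorsers, $n$ a polynomial, each with an independently generated key pair. An adversary is a probabilistic polynomial-time oracle machine; it gets $1^\lambda$, the parameters and all public keys, and may query the random oracle, a corruption oracle (endorser $\mapsto$ secret key), and a signing oracle ($i\in R\subseteq E$ and a message $M$ $\mapsto$ a signature of $M$ by $i$ for the ring $R$). In the games that have a *challenge*, it may once submit $(i_0,i_1,R,M)$ with $i_0,i_1\in R\subseteq E$ and obtains a signature of $M$ for $R$ by $i_b$, where $b$ is a secret bit. An endorser is *untouched* if it was never submitted to the corruption oracle and never used as signer in the signing oracle. $S$ is - *unforgeable* if every adversary has negligible probability of outputting $(R,M,\sigma)$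 with $\sigma$ valid for $(R,M)$, $|R|\ge 2$, no member of $R$ corrupted, and $M$ never submitted to the signing oracle; - *linkably anonymous* if, for a uniform bit $b$, every adversary has probability at most $\tfrac12+\mathrm{negl}(\lambda)$ of guessing $b$ after a challenge with $i_0\ne i_1$ both untouched (a run that violates this counts as lost); - *linkable* if every adversary has negligible probability of outputting a message $M$ and $k\ge 2$ distinct signatures, all valid for $(E,M)$, no two of them linked, where $k$ exceeds the number of endorsers who are corrupted or whose signature on $M$ it obtained from the signing oracle (for one such endorser: two unlinked signatures); - *non-slanderable* if every adversary has negligible probability, after obtaining by its challenge a signature $\sigma$ of an untouched endorser for $(R,M)$, of outputting a signature $\sigma^*\neq\sigma$ valid for $(R,M)$ and linked to $\sigma$. $S$ is *secure* if it has all four properties. **FCsLRS.** Let $l,\mu$ be functions of $\lambda$. $\mathsf{Init}$ chooses uniformly a $\lambda$-bit rigid RSA integer $N$ (a product of two distinct safe primes of equal length), a generator $u$ of the group $QR(N)$ of quadratic residues, and $g,h,y,t,s,\zeta\in QR(N)$. With $S(2^l,2^\mu)=\{2^l-2^\mu+1,\dots,2^l+2^\mu-1\}$, $\mathsf{KeyGen}$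 chooses uniformly a secret key $(e_1,e_2)$ of distinct $l/2$-bit primes with $e_2\in S(2^{l/2},2^\mu)$ such that $x=2e_1e_2+1$ is a prime in $S(2^l,2^\mu)$ and $e_1e_2$ is an $l$-bit product of two distinct safe primes; the public key is $x$. (If one of these sets is empty, fixed dummy values are used.) The value accumulated from public keys $y_1,\dots,y_k$ is $u^{y_1\cdots y_k}\bmod N$; $v$ is that of all keys of the ring and the signer's $w$ that of all other keys. All that follows is modulo $N$, $\tilde H$ is a random oracle into $\{0,\dots,\lfloor N/4\rfloor-1\}$, and $H_1$ one into $QR(N)$. For a message with transaction id $\mathrm{tid}$ and response $m$, put $g_{tid}=g^{\tilde H(\mathrm{tid})}$. The signer draws $r,\alpha_1,\alpha_2,\alpha_3$ uniformly from $\{0,\dots,\lfloor N/4\rfloor-1\}$ and computes $$T_1=g_{tid}^{r},\; T_2=h^r\zeta^{x+r},\; T_3=s^rg_{tid}^{e_2},\; T_4=wy^r,\; T_5=t^rg_{tid}^{2e_1},$$ $$u_1=g_{tid}^{\alpha_1},\; u_2=\zeta^{\alpha_1+\alpha_2},\; u_3=h^{\alpha_1},\; u_4=s^{\alpha_1},\;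 u_5=g_{tid}^{\alpha_3},\; u_6=w^{\alpha_2},\; u_7=g_{tid}^{2e_1\alpha_3},\; u_8=t^{\alpha_1},\; u_9=g_{tid}^{\alpha_2},$$ $c=H_1(m,u_1,\dots,u_9)$, $\tilde\alpha_1=\alpha_1+cr$, $\tilde\alpha_2=\alpha_2+cx$, $\tilde\alpha_3=r\alpha_2+rcx$, $\tilde\alpha_4=\alpha_3+ce_2$, $\tilde\alpha_5=r\alpha_3+rce_2$, and the tag $\tilde y=g_{tid}^{e_1+e_2}$; the signature consists of all $T_i,u_i,\tilde\alpha_i$ and $\tilde y$. $\mathsf{Verify}$ recomputes $g_{tid}$ and $c$, and checks that all $T_i$, $u_i$ and $\tilde y$ lie in $QR(N)$ and that $$g_{tid}^{\tilde\alpha_1}=u_1T_1^c,\quad \zeta^{\tilde\alpha_1+\tilde\alpha_2}h^{\tilde\alpha_1}=u_2u_3T_2^c,\quad g_{tid}^{\tilde\alpha_3}=T_1^{\tilde\alpha_2},\quad g_{tid}^{\tilde\alpha_5}=T_1^{\tilde\alpha_4},\quad g_{tid}^{\tilde\alpha_4}s^{\tilde\alpha_1}=T_3^cu_4u_5,$$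 $$u_6v^cy^{\tilde\alpha_3}=T_4^{\tilde\alpha_2},\quad t^{\tilde\alpha_5}g_{tid}^{\tilde\alpha_2}u_7=T_5^{\tilde\alpha_4}u_9g_{tid}^c,\quad \tilde y^{2c}s^{2\tilde\alpha_1}t^{\tilde\alpha_1}=(T_3^2T_5)^cu_4^2u_8.$$ Two signatures are linked iff their tags agree. **Anonymous Endorsement System (AES) on $S$.** It has a fixed endorsement set $E$ of $n(\lambda)\ge2$ endorsers ($n$ a polynomial), a threshold $1\le t\le n$, and a non-empty set of validators, at least half of them honest. To endorse a transaction response $M$, an endorser signs it for the ring $E$. An honest validator votes for $M$ iff the list of signatures submitted for $M$ consists of at least $t$ distinct, pairwise unlinked signatures, all valid for $(E,M)$; dishonest validators vote at will; the response is forwarded iff at least half of the validators, among them an honest one, vote for it. In the AES attacks all rings submitted are $E$. The AES is *secure* if, for every adversary, 1. (threshold) the probability is negligible that it outputs a response $M$ and signatures such that the dishonest validators can vote so that $M$ is forwarded, although fewer than $t$ endorsers are corrupted or have endorsed $M$; 2. (anonymity) if it names two untouched endorsers and a response, and one of the two, chosen by a fair coin, endorses it, it guesses which one with probability at most $\tfrac12+\mathrm{negl}(\lambda)$;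 3. (no framing) the probability is negligible that it outputs a valid signature, different from and linked to an endorsement by an otherwise untouched endorser of the same response; and, moreover, (4) dishonest validators cannot prevent a response for which all honest validators vote from being forwarded. **Theorem.** Let $S$ be a linkable ring signature scheme. If $S$ is unforgeable, linkably anonymous, linkable and non-slanderable, then $S$ is secure, and every Anonymous Endorsement System built on $S$ is secure in the random oracle model. In particular this holds for $S=\mathrm{FCsLRS}$, for all $l,\mu$. -/

import Mathlib

noncomputable section

open Finset

/-! ## Data, and probabilistic oracle programs with a step count

All objects handled by algorithms are binary trees.  Adversaries are programs of a small imperative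
language over trees (assignment, coin flip, oracle call, sequencing, conditional, loop). Storing
a value costs its size, an oracle call costs the sizes of the question and of the answer, and every
other step costs one unit. Up to a polynomial this is the time of a probabilistic oracle Turing
machine. -/

inductive Data : Type where
  | nil : Data
  | cons : Data → Data → Data
  deriving DecidableEq

namespace Data

def size : Data → ℕ
  | nil => 1
  | cons a b => a.size + b.size + 1

def hd : Data → Data
  | nil => nil
  | cons a _ => a

def tl : Data → Data
  | nil => nil
  | cons _ b => b

/-- The list `[a₁, …, aₖ]` is the tree `cons a₁ (… (cons aₖ nil))`. -/
def ofList : List Data → Data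
  | [] => nil
  | a :: as => cons a (ofList as)

def toList : Data → List Data
  | nil => []
  | cons a b => a :: toList b

/-- The unary numeral of `k`: a list of `k` empty trees. -/
def unary (k : ℕ) : Data := ofList (List.replicate k nil)

def ofUnary (d : Data) : ℕ := d.toList.length

def ofBool (b : Bool) : Data := if b then cons nil nil else nil

/-- `false` is the empty tree, every other tree counts as `true`. -/
def toBool (d : Data) : Bool := decide (d ≠ nil)

/-- Binary numerals, least significant bit first. -/
def ofNat (k : ℕ) : Data := ofList (k.bits.map ofBool)

def toNat (d : Data) : ℕ := Nat.ofDigits 2 (d.toList.map fun e => (e.toBool).toNat)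

end Data

inductive Expr : Type where
  | var : ℕ → Expr
  | nil : Expr
  | cons : Expr → Expr → Expr
  | hd : Expr → Expr
  | tl : Expr → Expr

abbrev Store := ℕ → Data

def Expr.eval (s : Store) : Expr → Data
  | .var x => s x
  | .nil => .nil
  | .cons a b => .cons (a.eval s) (b.eval s)
  | .hd a => (a.eval s).hd
  | .tl a => (a.eval s).tl

inductive Cmd : Type where
  | assign : ℕ → Expr → Cmd
  | flip : ℕ → Cmd
  | query : ℕ → Expr → Cmd
  | seq : Cmd → Cmd → Cmd
  | ite : Expr → Cmd → Cmd → Cmd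
  | loop : Expr → Cmd → Cmd

/-- `exec O T c k s st` runs the stack of commands `k` on the store `s` for at most `T` steps, where
`O` is a stateful randomized oracle, `st` its current state, and `c` the cost so far. It returns
the final cost and store (`none` if the run has not ended) and the final oracle state. -/
def exec {σ : Type} (O : Data → σ → PMF (Data × σ)) :
    ℕ → ℕ → List Cmd → Store → σ → PMF (Option (ℕ × Store) × σ)
  | _, c, [], s, st => PMF.pure (some (c, s), st)
  | 0, _, _ :: _, _, st => PMF.pure (none, st)
  | T + 1, c, .assign x e :: k, s, st =>
      exec O T (c + 1 + (e.eval s).size) k (Function.update s x (e.eval s)) st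
  | T + 1, c, .flip x :: k, s, st =>
      (PMF.uniformOfFintype Bool).bind fun b =>
        exec O T (c + 2) k (Function.update s x (Data.ofBool b)) st
  | T + 1, c, .query x e :: k, s, st =>
      (O (e.eval s) st).bind fun r =>
        exec O T (c + 1 + (e.eval s).size + r.1.size) k (Function.update s x r.1) r.2
  | T + 1, c, .seq a b :: k, s, st => exec O T (c + 1) (a :: b :: k) s st
  | T + 1, c, .ite e a b :: k, s, st =>
      exec O T (c + 1) ((if (e.eval s).toBool then a else b) :: k) s st
  | T + 1, c, .loop e a :: k, s, st =>
      exec O T (c + 1) (if (e.eval s).toBool then a :: .loop e a :: k else k) s st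

/-- A probabilistic polynomial time oracle machine: a program with a polynomial clock. -/
structure Adversary where
  prog : Cmd
  clock : Polynomial ℕ

/-- Run on input `x` (in variable `0`) with security parameter `lam`; the output is the final value
of variable `1`, or `none` if the total cost exceeds the clock. -/
def Adversary.run {σ : Type} (A : Adversary) (O : Data → σ → PMF (Data × σ)) (lam : ℕ) (x : Data)
    (st : σ) : PMF (Option Data × σ) :=
  (exec O (A.clock.eval lam) 0 [A.prog] (Function.update (fun _ => Data.nil) 0 x) st).map fun r =>
    (match r.1 with
      | none => none
      | some (c, s) => if c ≤ A.clock.eval lam then some (s 1) else none, r.2)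

def Negligible (f : ℕ → ℝ) : Prop :=
  Asymptotics.SuperpolynomialDecay Filter.atTop (fun lam : ℕ => (lam : ℝ)) f

/-! ## Randomized computations with a random oracle -/

inductive ROComp (α : Type) : Type where
  | pure : α → ROComp α
  | sample : PMF Data → (Data → ROComp α) → ROComp α
  | ask : Data → (Data → ROComp α) → ROComp α

namespace ROComp

def bind {α β : Type} : ROComp α → (α → ROComp β) → ROComp β
  | pure a, f => f a
  | sample p k, f => sample p fun d => (k d).bind f
  | ask q k, f => ask q fun d => (k d).bind f

instance : Monad ROComp where
  pure := ROComp.pure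
  bind := ROComp.bind

/-- The part of the random oracle that has been fixed so far. -/
abbrev Table := List (Data × Data)

/-- A new question `q` is answered by a fresh sample of `H q`, an old one as before. -/
def answer (H : Data → PMF Data) (q : Data) (τ : Table) : PMF (Data × Table) :=
  match τ.lookup q with
  | some a => PMF.pure (a, τ)
  | none => (H q).map fun a => (a, (q, a) :: τ)

def run {α : Type} (H : Data → PMF Data) : ROComp α → Table → PMF (α × Table)
  | pure a, τ => PMF.pure (a, τ)
  | sample p k, τ => p.bind fun d => (k d).run H τ
  | ask q k, τ => (answer H q τ).bind fun r => (k r.1).run H r.2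

def draw (p : PMF Data) : ROComp Data := sample p pure

def hash (q : Data) : ROComp Data := ask q pure

end ROComp

/-! ## Linkable ring signature schemes -/

/-- Syntax of a linkable ring signature scheme in the random oracle model: the seven algorithms and
the law `oracle par q` of the answer of the random oracle to `q`.  Secret key first, public key
second in `keyGen`. A set of public keys is listed in the order of its owners. -/
structure LRS where
  oracle : Data → Data → PMF Data
  init : ℕ → PMF Data
  keyGen : ℕ → Data → ROComp (Data × Data)
  accumulatePubKey : Data → List Data → Data
  generatePubKeyWitness : Data → List Data → Data
  /-- parameters, public keys of the ring, accumulated value, witness, message, secret key -/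
  sign : Data → List Data → Data → Data → Data → Data → ROComp Data
  /-- parameters, public keys of the ring, accumulated value, message, signature -/
  verify : Data → List Data → Data → Data → Data → ROComp Bool
  link : Data → Data → Data → Bool

namespace LRS

/-- The key pairs `(skᵢ, pkᵢ)` of `n` endorsers, each generated by its owner. -/
def keyGenAll (S : LRS) (lam : ℕ) (par : Data) : ℕ → ROComp (List (Data × Data))
  | 0 => ROComp.pure []
  | n + 1 => do
      let ks ← S.keyGenAll lam par n
      let k ← S.keyGen lam par
      ROComp.pure (ks ++ [k])

def sk {n : ℕ} (keys : List (Data × Data)) (i : Fin n) : Data := (keys.getD i (.nil, .nil)).1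

def pk {n : ℕ} (keys : List (Data × Data)) (i : Fin n) : Data := (keys.getD i (.nil, .nil)).2

def ringKeys {n : ℕ} (keys : List (Data × Data)) (R : Finset (Fin n)) : List Data :=
  (R.sort (· ≤ ·)).map (pk keys)

/-- Endorser `i` signs `M` on behalf of the ring `R`. -/
def signAs (S : LRS) {n : ℕ} (par : Data) (keys : List (Data × Data)) (i : Fin n)
    (R : Finset (Fin n)) (M : Data) : ROComp Data :=
  S.sign par (ringKeys keys R) (S.accumulatePubKey par (ringKeys keys R))
    (S.generatePubKeyWitness par (ringKeys keys (R.erase i))) M (sk keys i)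

def verifyFor (S : LRS) {n : ℕ} (par : Data) (keys : List (Data × Data)) (R : Finset (Fin n))
    (M sig : Data) : ROComp Bool :=
  S.verify par (ringKeys keys R) (S.accumulatePubKey par (ringKeys keys R)) M sig

def verifyAll (S : LRS) {n : ℕ} (par : Data) (keys : List (Data × Data)) (R : Finset (Fin n))
    (M : Data) : List Data → ROComp Bool
  | [] => ROComp.pure true
  | sig :: sigs => do
      let b ← S.verifyFor par keys R M sig
      if b then S.verifyAll par keys R M sigs else ROComp.pure false

end LRS

/-! ## The attack environment: random oracle, corruption oracle, signing oracle, challenge -/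

def decodeIndex (n : ℕ) (d : Data) : Option (Fin n) :=
  if h : d.ofUnary < n then some ⟨d.ofUnary, h⟩ else none

def decodeRing (n : ℕ) (d : Data) : Finset (Fin n) :=
  (d.toList.filterMap (decodeIndex n)).toFinset

inductive Query (n : ℕ) : Type where
  | hash (q : Data)
  | corrupt (i : Fin n)
  | sign (i : Fin n) (R : Finset (Fin n)) (M : Data)
  | challenge (i₀ i₁ : Fin n) (R : Finset (Fin n)) (M : Data)
  | malformed

/-- The questions are the lists `[0, q]`, `[1, i]`, `[2, i, R, M]` and `[3, i₀, i₁, R, M]`, with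
unary numerals for the first entry and for endorsers. -/
def decodeQuery (n : ℕ) (d : Data) : Query n :=
  match d.toList with
  | [a, x] =>
      if a = .unary 0 then .hash x
      else if a = .unary 1 then
        match decodeIndex n x with
        | some i => .corrupt i
        | none => .malformed
      else .malformed
  | [a, x, R, M] =>
      if a = .unary 2 then
        match decodeIndex n x with
        | some i => .sign i (decodeRing n R) M
        | none => .malformed
      else .malformed
  | [a, x, y, R, M] =>
      if a = .unary 3 then
        match decodeIndex n x, decodeIndex n y with
        | some i, some j => .challenge i j (decodeRing n R) M
        | _, _ => .malformed
      else .malformed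
  | _ => .malformed

structure SignRecord (n : ℕ) where
  signer : Fin n
  ring : Finset (Fin n)
  msg : Data

structure ChallengeRecord (n : ℕ) where
  left : Fin n
  right : Fin n
  ring : Finset (Fin n)
  msg : Data
  sig : Data

structure EnvState (n : ℕ) where
  table : ROComp.Table
  corrupted : Finset (Fin n)
  signed : List (SignRecord n)
  challenge : Option (ChallengeRecord n)

/-- The environment with secret bit `b`.  Only the first challenge is answered, by a signature of
the left endorser if `b = false` and of the right one if `b = true`. -/
def LRS.environment (S : LRS) {n : ℕ} (par : Data) (keys : List (Data × Data)) (b : Bool)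
    (d : Data) (st : EnvState n) : PMF (Data × EnvState n) :=
  match decodeQuery n d with
  | .hash q => (ROComp.answer (S.oracle par) q st.table).map fun r => (r.1, { st with table := r.2 })
  | .corrupt i => PMF.pure (LRS.sk keys i, { st with corrupted := insert i st.corrupted })
  | .sign i R M =>
      if i ∈ R then
        ((S.signAs par keys i R M).run (S.oracle par) st.table).map fun r =>
          (r.1, { st with table := r.2, signed := ⟨i, R, M⟩ :: st.signed })
      else PMF.pure (.nil, st)
  | .challenge i j R M =>
      if i ∈ R ∧ j ∈ R ∧ st.challenge.isNone then
        ((S.signAs par keys (if b then j else i) R M).run (S.oracle par) st.table).map fun r =>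
          (r.1, { st with table := r.2, challenge := some ⟨i, j, R, M, r.1⟩ })
      else PMF.pure (.nil, st)
  | .malformed => PMF.pure (.nil, st)

structure Outcome (n : ℕ) where
  par : Data
  keys : List (Data × Data)
  output : Option Data
  state : EnvState n

/-- Initialization, key generation of `n` endorsers, and the attack of `A`, who is given `1^lam`, the
parameters and all public keys. -/
def LRS.attack (S : LRS) (A : Adversary) (n lam : ℕ) (b : Bool) : PMF (Outcome n) :=
  (S.init lam).bind fun par =>
  ((S.keyGenAll lam par n).run (S.oracle par) []).bind fun kt =>
  (A.run (S.environment (n := n) par kt.1 b) lam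
      (.ofList [.unary lam, par, .ofList (kt.1.map Prod.snd)]) ⟨kt.2, ∅, [], none⟩).map fun r =>
  ⟨par, kt.1, r.1, r.2⟩

/-- What an adversary claims at the end of an attack: a ring, a message, a list of signatures.
It is the output `cons R (cons M sigs)`. -/
structure Claim (n : ℕ) where
  ring : Finset (Fin n)
  msg : Data
  sigs : List Data

def decodeClaim (n : ℕ) (d : Data) : Claim n :=
  ⟨decodeRing n d.hd, d.tl.hd, d.tl.tl.toList⟩

namespace Outcome

variable {n : ℕ}

/-- Endorsers whose secret key, or whose signature on `M`, the adversary has obtained. -/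
def involved (o : Outcome n) (M : Data) : Finset (Fin n) :=
  o.state.corrupted ∪ (o.state.signed.filterMap fun r =>
    if r.msg = M then some r.signer else none).toFinset

/-- The endorser has been used neither with the corruption oracle nor with the signing oracle. -/
def Untouched (o : Outcome n) (i : Fin n) : Prop :=
  i ∉ o.state.corrupted ∧ ∀ r ∈ o.state.signed, r.signer ≠ i

end Outcome

/-- Winning probability of a game. -/
def winProb (G : PMF Bool) : ℝ := (G true).toReal

open Classical in
/-- `referee S A n lam b P check`: the adversary wins the attack with secret bit `b` if it terminates
with a claim such that `P` holds and the computation `check` returns `true`. -/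
def LRS.referee (S : LRS) (A : Adversary) (n lam : ℕ) (b : Bool)
    (P : Outcome n → Claim n → Prop) (check : Outcome n → Claim n → ROComp Bool) : PMF Bool :=
  (S.attack A n lam b).bind fun o =>
    match o.output with
    | none => PMF.pure false
    | some d =>
        if P o (decodeClaim n d) then
          ((check o (decodeClaim n d)).run (S.oracle o.par) o.state.table).map Prod.fst
        else PMF.pure false

/-- The first claimed signature is valid. -/
def LRS.checkHead (S : LRS) {n : ℕ} (o : Outcome n) (c : Claim n) : ROComp Bool :=
  match c.sigs with
  | [] => ROComp.pure false
  | sig :: _ => S.verifyFor o.par o.keys c.ring c.msg sig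

/-- All claimed signatures are valid. -/
def LRS.checkAll (S : LRS) {n : ℕ} (o : Outcome n) (c : Claim n) : ROComp Bool :=
  S.verifyAll o.par o.keys c.ring c.msg c.sigs

open Classical in
/-- Guessing game: the secret bit is uniform, the adversary outputs a guess, and it wins if the
guess is right and the attack satisfies `P`. -/
def LRS.guessGame (S : LRS) (A : Adversary) (n lam : ℕ) (P : Outcome n → Prop) : PMF Bool :=
  (PMF.uniformOfFintype Bool).bind fun b =>
    (S.attack A n lam b).map fun o =>
      match o.output with
      | none => false
      | some d => decide (P o ∧ d.toBool = b)

/-! ## The four security notions -/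

namespace LRS

def unforgeabilityGame (S : LRS) (A : Adversary) (n lam : ℕ) : PMF Bool :=
  S.referee A n lam false
    (fun o c => o.state.challenge = none ∧ 2 ≤ #c.ring ∧ Disjoint c.ring o.state.corrupted ∧
      ∀ r ∈ o.state.signed, r.msg ≠ c.msg)
    S.checkHead

/-- No adversary forges a signature on a message not submitted to the signing oracle, for a ring
of at least two endorsers, all honest. -/
def Unforgeable (S : LRS) : Prop :=
  ∀ (A : Adversary) (n : Polynomial ℕ),
    Negligible fun lam => winProb (S.unforgeabilityGame A (n.eval lam) lam)

/-- The challenge was asked for two members of a ring that are untouched. -/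
def AnonymityLegal {n : ℕ} (o : Outcome n) : Prop :=
  ∃ ch, o.state.challenge = some ch ∧ ch.left ≠ ch.right ∧ o.Untouched ch.left ∧
    o.Untouched ch.right

def anonymityGame (S : LRS) (A : Adversary) (n lam : ℕ) : PMF Bool :=
  S.guessGame A n lam AnonymityLegal

/-- No adversary can tell which of two honest endorsers of its choice has signed. -/
def LinkablyAnonymous (S : LRS) : Prop :=
  ∀ (A : Adversary) (n : Polynomial ℕ), ∃ ε : ℕ → ℝ, Negligible ε ∧
    ∀ lam, winProb (S.anonymityGame A (n.eval lam) lam) ≤ 1 / 2 + ε lam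

/-- The signatures are distinct and no two of them are linked. -/
def PairwiseUnlinked (S : LRS) (par : Data) (sigs : List Data) : Prop :=
  sigs.Nodup ∧ sigs.Pairwise fun σ₁ σ₂ => S.link par σ₁ σ₂ = false

def linkabilityGame (S : LRS) (A : Adversary) (n lam : ℕ) : PMF Bool :=
  S.referee A n lam false
    (fun o c => o.state.challenge = none ∧ c.ring = univ ∧ 2 ≤ c.sigs.length ∧
      #(o.involved c.msg) < c.sigs.length ∧ S.PairwiseUnlinked o.par c.sigs)
    S.checkAll

/-- No adversary produces, for one message and the whole endorsement set, two or more distinct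
valid signatures, more of them than endorsers whose key or signature on the message it has
obtained, such that no two are linked. With one such endorser: no two unlinked signatures. -/
def Linkable (S : LRS) : Prop :=
  ∀ (A : Adversary) (n : Polynomial ℕ),
    Negligible fun lam => winProb (S.linkabilityGame A (n.eval lam) lam)

/-- The adversary has obtained, by its challenge, a signature of an otherwise untouched endorser
and claims another signature, linked to it, for the same ring and message. -/
def Slander (S : LRS) {n : ℕ} (o : Outcome n) (c : Claim n) : Prop :=
  ∃ ch, o.state.challenge = some ch ∧ ch.left = ch.right ∧ o.Untouched ch.left ∧
    c.ring = ch.ring ∧ c.msg = ch.msg ∧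
    ∃ sig, c.sigs.head? = some sig ∧ sig ≠ ch.sig ∧ S.link o.par sig ch.sig = true

def slanderGame (S : LRS) (A : Adversary) (n lam : ℕ) : PMF Bool :=
  S.referee A n lam false S.Slander S.checkHead

/-- No adversary produces a valid signature linked to a signature of an honest endorser. -/
def NonSlanderable (S : LRS) : Prop :=
  ∀ (A : Adversary) (n : Polynomial ℕ),
    Negligible fun lam => winProb (S.slanderGame A (n.eval lam) lam)

/-- Security of a linkable ring signature scheme. -/
structure Secure (S : LRS) : Prop where
  unforgeable : S.Unforgeable
  linkablyAnonymous : S.LinkablyAnonymous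
  linkable : S.Linkable
  nonSlanderable : S.NonSlanderable

end LRS

/-! ## The Anonymous Endorsement System -/

/-- A deployment of the endorsement system on a ring signature scheme: a fixed endorsement set
`Fin n` with polynomially many members, a threshold `t`, and validators, at least half of them
honest. -/
structure AES where
  scheme : LRS
  endorsers : Polynomial ℕ
  two_le : ∀ lam, 2 ≤ endorsers.eval lam
  threshold : ℕ → ℕ
  threshold_pos : ∀ lam, 1 ≤ threshold lam
  threshold_le : ∀ lam, threshold lam ≤ endorsers.eval lam
  validators : ℕ → ℕ
  validators_pos : ∀ lam, 0 < validators lam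
  honest : ∀ lam, Finset (Fin (validators lam))
  half_honest : ∀ lam, validators lam ≤ 2 * #(honest lam)

namespace AES

variable (E : AES)

/-- The number of members of the endorsement set. -/
abbrev size (lam : ℕ) : ℕ := E.endorsers.eval lam

/-- Votes of the validators in which the honest ones vote `verdict`; the others vote at will. -/
def Consistent (lam : ℕ) (verdict : Prop) (votes : Finset (Fin (E.validators lam))) : Prop :=
  ∀ v ∈ E.honest lam, (v ∈ votes ↔ verdict)

/-- A transaction is forwarded to the ordering service if at least half of the validators are in
favour, by an honest validator that is. -/
def Forwarded (lam : ℕ) (votes : Finset (Fin (E.validators lam))) : Prop :=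
  E.validators lam ≤ 2 * #votes ∧ ∃ v ∈ E.honest lam, v ∈ votes

open Classical in
/-- The policy test of an honest validator on the endorsements submitted for one transaction response:
the endorsements are for the endorsement set, at least `t` in number, pairwise unlinked, and
all of them are valid. -/
def validate (lam : ℕ) (o : Outcome (E.size lam)) (c : Claim (E.size lam)) : ROComp Bool :=
  if c.ring = univ ∧ E.threshold lam ≤ c.sigs.length ∧ E.scheme.PairwiseUnlinked o.par c.sigs then
    E.scheme.checkAll o c
  else ROComp.pure false

/-- Endorsers endorse for their fixed endorsement set only. -/
def Admissible {n : ℕ} (o : Outcome n) : Prop :=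
  (∀ r ∈ o.state.signed, r.ring = univ) ∧ ∀ ch ∈ o.state.challenge, ch.ring = univ

open Classical in
/-- The adversary wins if the dishonest validators can vote such that its transaction response is
forwarded, although fewer than `t` endorsers are corrupt or have endorsed this response. -/
def thresholdGame (A : Adversary) (lam : ℕ) : PMF Bool :=
  E.scheme.referee A (E.size lam) lam false
    (fun o c => Admissible o ∧ o.state.challenge = none ∧ #(o.involved c.msg) < E.threshold lam)
    (fun o c => do
      let verdict ← E.validate lam o c
      ROComp.pure (decide (∃ votes, E.Consistent lam (verdict = true) votes ∧
        E.Forwarded lam votes)))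

/-- Two honest endorsers are chosen by the adversary, one of them, chosen by a fair coin, endorses a
transaction response of the adversary's choice, and the adversary guesses who it was. -/
def anonymityGame (A : Adversary) (lam : ℕ) : PMF Bool :=
  E.scheme.guessGame A (E.size lam) lam fun o => Admissible o ∧ LRS.AnonymityLegal o

/-- The adversary wins if it submits a valid endorsement that makes the endorsement of an honest
endorser appear as a double endorsement. -/
def framingGame (A : Adversary) (lam : ℕ) : PMF Bool :=
  E.scheme.referee A (E.size lam) lam false
    (fun o c => Admissible o ∧ E.scheme.Slander o c)
    E.scheme.checkHead

/-- Security of the endorsement system in the random oracle model. -/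
structure Secure : Prop where
  /-- No transaction response is forwarded without the support of `t` endorsers, and none is counted
  twice. -/
  threshold : ∀ A : Adversary, Negligible fun lam => winProb (E.thresholdGame A lam)
  /-- The endorsements do not reveal who endorsed. -/
  anonymity : ∀ A : Adversary, ∃ ε : ℕ → ℝ, Negligible ε ∧
    ∀ lam, winProb (E.anonymityGame A lam) ≤ 1 / 2 + ε lam
  /-- No honest endorser can be framed. -/
  framing : ∀ A : Adversary, Negligible fun lam => winProb (E.framingGame A lam)
  /-- Dishonest validators cannot stop a transaction that passes the test of the honest ones. -/
  robust : ∀ lam votes, E.Consistent lam True votes → E.Forwarded lam votes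

end AES

/-! ## The scheme FCsLRS -/

namespace FCsLRS

def IsSafePrime (p : ℕ) : Prop :=
  ∃ p', p = 2 * p' + 1 ∧ p.Prime ∧ p'.Prime ∧ Odd p'

open Classical in
/-- RSA integers of `k` bits: products of two distinct safe primes. -/
def rsa (k : ℕ) : Finset ℕ :=
  (range (2 ^ k)).filter fun N => N.size = k ∧
    ∃ p q, IsSafePrime p ∧ IsSafePrime q ∧ p ≠ q ∧ N = p * q

open Classical in
/-- Rigid integers of `k` bits: the two safe primes have the same length. -/
def rig (k : ℕ) : Finset ℕ :=
  (range (2 ^ k)).filter fun N => N.size = k ∧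
    ∃ p q, IsSafePrime p ∧ IsSafePrime q ∧ p ≠ q ∧ p.size = q.size ∧ N = p * q

/-- The quadratic residues modulo `N`, as numbers below `N`. -/
def QR (N : ℕ) : Finset ℕ :=
  ((range N).filter fun a => a.Coprime N).image fun a => a ^ 2 % N

open Classical in
/-- The generators of the group of quadratic residues. -/
def generators (N : ℕ) : Finset ℕ :=
  (QR N).filter fun u => ∀ a ∈ QR N, ∃ k : ℕ, u ^ k % N = a

/-- The sphere `{2^l - 2^μ + 1, …, 2^l + 2^μ - 1}`. -/
def sphere (l μ : ℕ) : Finset ℕ := Ioo (2 ^ l - 2 ^ μ) (2 ^ l + 2 ^ μ)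

open Classical in
/-- The secret keys `(e₁, e₂)` whose public key `2 e₁ e₂ + 1` lies in the accumulator domain. -/
def secretKeys (l μ : ℕ) : Finset (ℕ × ℕ) :=
  (range (2 ^ (l / 2)) ×ˢ range (2 ^ (l / 2))).filter fun e =>
    e.1 ≠ e.2 ∧ e.1.Prime ∧ e.2.Prime ∧ e.1.size = l / 2 ∧ e.2.size = l / 2 ∧
    e.2 ∈ sphere (l / 2) μ ∧
    (2 * e.1 * e.2 + 1).Prime ∧ e.1 * e.2 ∈ rsa l ∧ 2 * e.1 * e.2 + 1 ∈ sphere l μ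

open Classical in
/-- The uniform law on a finite set of numbers (on `{0}` if the set is empty). -/
def uniform (s : Finset ℕ) : PMF ℕ :=
  if h : s.Nonempty then PMF.uniformOfFinset s h else PMF.pure 0

open Classical in
def uniformKey (l μ : ℕ) : PMF (ℕ × ℕ) :=
  if h : (secretKeys l μ).Nonempty then PMF.uniformOfFinset (secretKeys l μ) h else PMF.pure (0, 0)

structure Params where
  N : ℕ
  u : ℕ
  g : ℕ
  h : ℕ
  y : ℕ
  t : ℕ
  s : ℕ
  ζ : ℕ

def encodeNats (ks : List ℕ) : Data := .ofList (ks.map Data.ofNat)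

def Params.encode (P : Params) : Data := encodeNats [P.N, P.u, P.g, P.h, P.y, P.t, P.s, P.ζ]

def Params.decode (d : Data) : Params :=
  let k := fun i => (d.toList.getD i .nil).toNat
  ⟨k 0, k 1, k 2, k 3, k 4, k 5, k 6, k 7⟩

/-- A signature: `T₁, …, T₅`, the commitments `u₁, …, u₉`, the responses `α̃₁, …, α̃₅`, and the tag. -/
structure Sig where
  T : ℕ → ℕ
  u : ℕ → ℕ
  a : ℕ → ℕ
  tag : ℕ

def Sig.encode (σ : Sig) : Data :=
  encodeNats ([σ.tag] ++ (List.range' 1 5).map σ.T ++ (List.range' 1 9).map σ.u ++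
    (List.range' 1 5).map σ.a)

def Sig.decode (d : Data) : Sig where
  tag := (d.toList.getD 0 .nil).toNat
  T i := (d.toList.getD i .nil).toNat
  u i := (d.toList.getD (5 + i) .nil).toNat
  a i := (d.toList.getD (14 + i) .nil).toNat

/-- A well-formed signature: canonically encoded, group elements in `QR N`. -/
def Sig.WellFormed (N : ℕ) (d : Data) : Prop :=
  (Sig.decode d).encode = d ∧ (Sig.decode d).tag ∈ QR N ∧
    (∀ i ∈ Icc 1 5, (Sig.decode d).T i ∈ QR N) ∧ ∀ i ∈ Icc 1 9, (Sig.decode d).u i ∈ QR N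

/-- The questions to the random oracles `H̃` (transaction identifiers) and `H₁` (challenges). -/
def askTid (tid : Data) : Data := .cons .nil tid

def askChallenge (m : Data) (u : ℕ → ℕ) : Data :=
  .cons (.cons .nil .nil) (.cons m (encodeNats ((List.range' 1 9).map u)))

/-- `H̃` has values in `{0, …, ⌊N/4⌋ - 1}` and `H₁` in `QR N`. -/
def oracle (par q : Data) : PMF Data :=
  (uniform (if q.hd = .nil then range ((Params.decode par).N / 4)
    else QR (Params.decode par).N)).map Data.ofNat

def init (lam : ℕ) : PMF Data := do
  let N ← uniform (rig lam)
  let u ← uniform (generators N)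
  let g ← uniform (QR N)
  let h ← uniform (QR N)
  let y ← uniform (QR N)
  let t ← uniform (QR N)
  let s ← uniform (QR N)
  let ζ ← uniform (QR N)
  return Params.encode ⟨N, u, g, h, y, t, s, ζ⟩

def keyGen (l μ : ℕ) : ROComp (Data × Data) := do
  let d ← ROComp.draw ((uniformKey l μ).map fun e => encodeNats [e.1, e.2])
  let e₁ := (d.toList.getD 0 .nil).toNat
  let e₂ := (d.toList.getD 1 .nil).toNat
  return (d, Data.ofNat (2 * e₁ * e₂ + 1))

/-- `f(… f(f(u, y₁), y₂) …, yₖ)` for `f(u, x) = u^x mod N`. -/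
def accumulate (par : Data) (pks : List Data) : Data :=
  let P := Params.decode par
  .ofNat (pks.foldl (fun v p => v ^ p.toNat % P.N) P.u)

def drawExponent (N : ℕ) : ROComp ℕ := do
  let d ← ROComp.draw ((uniform (range (N / 4))).map Data.ofNat)
  return d.toNat

/-- The parameter `g_tid = g^{H̃(tid)} mod N` of a transaction. -/
def gTid (P : Params) (tid : Data) : ROComp ℕ := do
  let x ← ROComp.hash (askTid tid)
  return P.g ^ x.toNat % P.N

/-- Signing of the transaction response `M.tl` with transaction identifier `M.hd`. -/
def sign (par w' M key : Data) : ROComp Data := do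
  let P := Params.decode par
  let w := w'.toNat
  let e₁ := (key.toList.getD 0 .nil).toNat
  let e₂ := (key.toList.getD 1 .nil).toNat
  let x := 2 * e₁ * e₂ + 1
  let gt ← gTid P M.hd
  let r ← drawExponent P.N
  let α₁ ← drawExponent P.N
  let α₂ ← drawExponent P.N
  let α₃ ← drawExponent P.N
  let T : ℕ → ℕ := fun i => match i with
    | 1 => gt ^ r % P.N
    | 2 => P.h ^ r * P.ζ ^ (x + r) % P.N
    | 3 => P.s ^ r * gt ^ e₂ % P.N
    | 4 => w * P.y ^ r % P.N
    | 5 => P.t ^ r * gt ^ (2 * e₁) % P.N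
    | _ => 0
  let u : ℕ → ℕ := fun i => match i with
    | 1 => gt ^ α₁ % P.N
    | 2 => P.ζ ^ (α₁ + α₂) % P.N
    | 3 => P.h ^ α₁ % P.N
    | 4 => P.s ^ α₁ % P.N
    | 5 => gt ^ α₃ % P.N
    | 6 => w ^ α₂ % P.N
    | 7 => gt ^ (2 * e₁ * α₃) % P.N
    | 8 => P.t ^ α₁ % P.N
    | 9 => gt ^ α₂ % P.N
    | _ => 0
  let c' ← ROComp.hash (askChallenge M.tl u)
  let c := c'.toNat
  let a : ℕ → ℕ := fun i => match i with
    | 1 => α₁ + c * r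
    | 2 => α₂ + c * x
    | 3 => r * α₂ + r * c * x
    | 4 => α₃ + c * e₂
    | 5 => r * α₃ + r * c * e₂
    | _ => 0
  return Sig.encode ⟨T, u, a, gt ^ (e₁ + e₂) % P.N⟩

open Classical in
def verify (par v' M d : Data) : ROComp Bool := do
  let P := Params.decode par
  let v := v'.toNat
  let σ := Sig.decode d
  let gt ← gTid P M.hd
  let c' ← ROComp.hash (askChallenge M.tl σ.u)
  let c := c'.toNat
  return decide (Sig.WellFormed P.N d ∧
    gt ^ σ.a 1 ≡ σ.u 1 * σ.T 1 ^ c [MOD P.N] ∧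
    P.ζ ^ (σ.a 2 + σ.a 1) * P.h ^ σ.a 1 ≡ σ.u 2 * σ.u 3 * σ.T 2 ^ c [MOD P.N] ∧
    gt ^ σ.a 3 ≡ σ.T 1 ^ σ.a 2 [MOD P.N] ∧
    gt ^ σ.a 5 ≡ σ.T 1 ^ σ.a 4 [MOD P.N] ∧
    gt ^ σ.a 4 * P.s ^ σ.a 1 ≡ σ.T 3 ^ c * σ.u 4 * σ.u 5 [MOD P.N] ∧
    σ.u 6 * v ^ c * P.y ^ σ.a 3 ≡ σ.T 4 ^ σ.a 2 [MOD P.N] ∧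
    P.t ^ σ.a 5 * gt ^ σ.a 2 * σ.u 7 ≡ σ.T 5 ^ σ.a 4 * σ.u 9 * gt ^ c [MOD P.N] ∧
    σ.tag ^ (2 * c) * P.s ^ (2 * σ.a 1) * P.t ^ σ.a 1 ≡
      (σ.T 3 ^ 2 * σ.T 5) ^ c * σ.u 4 ^ 2 * σ.u 8 [MOD P.N])

/-- Two signatures are linked if their tags agree. -/
def link (σ₁ σ₂ : Data) : Bool := decide ((Sig.decode σ₁).tag = (Sig.decode σ₂).tag)

/-- Fabric's constant-sized linkable ring signature scheme, for the accumulator with the length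
parameters `l` and `μ`, as functions of the security parameter. -/
def scheme (l μ : ℕ → ℕ) : LRS where
  oracle := oracle
  init := init
  keyGen lam _ := keyGen (l lam) (μ lam)
  accumulatePubKey := accumulate
  generatePubKeyWitness := accumulate
  sign par _ _ w M key := sign par w M key
  verify par _ v M σ := verify par v M σ
  link _ := link

end FCsLRS

end

open Finset

/-! ## Computations with a random oracle -/

namespace ROComp

/-! Security of the scheme is the bundle of the four assumed properties, so the content lies in the
endorsement system. Every attack on the system is already an attack on the scheme, by the same
adversary with the same endorsers and oracles. No new adversary is built: the games are compared
outcome by outcome over one common attack.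

For anonymity and framing, the system's games are those of the scheme with the extra winning
condition that all rings are the full endorsement set, so winning only gets harder.

For the threshold, forwarding needs an honest vote, and the honest validators alone are at least
half. Hence the dishonest votes are irrelevant and only the honest verdict counts
(`exists_forwarded_iff`). A positive verdict means at least `t` valid, pairwise unlinked signatures,
while fewer than `t` endorsers are involved. Two or more such signatures break linkability. A single
one forces `t = 1` with nobody involved, so it is a forgery for a ring of at least two uncorrupted
endorsers. This gives the bound `winProb_thresholdGame_le` by a sum of two negligible functions.
Robustness is counting.

FCsLRS enters only as an instance: its arithmetic plays no role, and its four properties remain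
hypotheses. -/

theorem bind_pure {α : Type} (x : ROComp α) : x.bind ROComp.pure = x := by
  induction x with
  | pure a => rfl
  | sample p k ih => simp [ROComp.bind, ih]
  | ask q k ih => simp [ROComp.bind, ih]

end ROComp

/-! ## Comparison of games -/

theorem winProb_nonneg (G : PMF Bool) : 0 ≤ winProb G := ENNReal.toReal_nonneg

theorem winProb_mono {G G' : PMF Bool} (h : G true ≤ G' true) : winProb G ≤ winProb G' :=
  ENNReal.toReal_mono (G'.apply_ne_top true) h

theorem winProb_le_add {G G₁ G₂ : PMF Bool} (h : G true ≤ G₁ true + G₂ true) :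
    winProb G ≤ winProb G₁ + winProb G₂ := by
  unfold winProb
  rw [← ENNReal.toReal_add (G₁.apply_ne_top true) (G₂.apply_ne_top true)]
  exact ENNReal.toReal_mono
    (ENNReal.add_ne_top.2 ⟨G₁.apply_ne_top true, G₂.apply_ne_top true⟩) h

theorem PMF.bind_apply_mono {α β : Type} (p : PMF α) {f g : α → PMF β} {b : β}
    (h : ∀ a, f a b ≤ g a b) : p.bind f b ≤ p.bind g b := by
  simp only [PMF.bind_apply]
  exact ENNReal.tsum_le_tsum fun a => mul_le_mul_right (h a) _

/-- A union bound made after conditioning on the common experiment `p`. It lets one attack be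
charged to two games, with the choice of game depending on the outcome `a`. -/
theorem PMF.bind_apply_le_add {α β : Type} (p : PMF α) {f g₁ g₂ : α → PMF β} {b : β}
    (h : ∀ a, f a b ≤ g₁ a b + g₂ a b) : p.bind f b ≤ p.bind g₁ b + p.bind g₂ b := by
  simp only [PMF.bind_apply]
  rw [← ENNReal.tsum_add]
  refine ENNReal.tsum_le_tsum fun a => ?_
  rw [← mul_add]
  exact mul_le_mul_right (h a) _

/-- Superpolynomial decay constrains absolute values, hence the lower bound `0` on `f`; winning
probabilities satisfy it. -/
theorem Negligible.of_le {f g : ℕ → ℝ} (hg : Negligible g) (h0 : ∀ lam, 0 ≤ f lam)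
    (h : ∀ lam, f lam ≤ g lam) : Negligible f :=
  Asymptotics.SuperpolynomialDecay.trans_abs_le hg fun lam => by
    simpa [abs_of_nonneg (h0 lam)] using (h lam).trans (le_abs_self _)

/-! ### Strengthened winning conditions, and claims with a single signature -/

namespace LRS

variable (S : LRS) (A : Adversary) (n lam : ℕ)

/-- The attack and the final check do not depend on the winning condition, so strengthening the
condition only turns some outcomes into certain losses. -/
theorem winProb_referee_mono (b : Bool) {P Q : Outcome n → Claim n → Prop}
    (check : Outcome n → Claim n → ROComp Bool) (h : ∀ o c, P o c → Q o c) :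
    winProb (S.referee A n lam b P check) ≤ winProb (S.referee A n lam b Q check) := by
  refine winProb_mono (PMF.bind_apply_mono _ fun o => ?_)
  rcases o.output with _ | d
  · exact le_rfl
  · by_cases hP : P o (decodeClaim n d)
    · simp only [if_pos hP, if_pos (h _ _ hP), le_refl]
    · simp [if_neg hP]

theorem winProb_guessGame_mono {P Q : Outcome n → Prop} (h : ∀ o, P o → Q o) :
    winProb (S.guessGame A n lam P) ≤ winProb (S.guessGame A n lam Q) := by
  refine winProb_mono (PMF.bind_apply_mono _ fun b => PMF.bind_apply_mono _ fun o => ?_)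
  dsimp only [Function.comp]
  rcases o.output with _ | d
  · exact le_rfl
  · by_cases hP : P o
    · simp [hP, h o hP]
    · simp [hP]

/-- Identifies the linkability check with the forgery check when one signature is claimed: the
recursion ends by returning the bit just computed, which the right unit law removes. -/
theorem verifyAll_singleton {n : ℕ} (par : Data) (keys : List (Data × Data))
    (R : Finset (Fin n)) (M sig : Data) :
    S.verifyAll par keys R M [sig] = S.verifyFor par keys R M sig := by
  change (S.verifyFor par keys R M sig).bind
    (fun b => if b then ROComp.pure true else ROComp.pure false) = _
  convert ROComp.bind_pure _ using 2
  funext b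
  cases b <;> rfl

end LRS

/-! ## The endorsement system -/

namespace AES

variable (E : AES)

theorem forwarded_of_honest_subset (lam : ℕ) {votes : Finset (Fin (E.validators lam))}
    (h : E.honest lam ⊆ votes) : E.Forwarded lam votes := by
  have h1 := E.half_honest lam
  have h2 := E.validators_pos lam
  have h3 := card_le_card h
  obtain ⟨v, hv⟩ : (E.honest lam).Nonempty := card_pos.1 (by omega)
  exact ⟨by omega, v, hv, h hv⟩

/-- Dishonest validators can neither have a response forwarded that fails the test of the honest
ones, nor stop one that passes it. -/
theorem exists_forwarded_iff (lam : ℕ) (verdict : Prop) :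
    (∃ votes, E.Consistent lam verdict votes ∧ E.Forwarded lam votes) ↔ verdict := by
  constructor
  · rintro ⟨votes, hc, -, v, hv, hv'⟩
    -- The dishonest validators may be exactly half and reach the quorum alone; the clause of
    -- `Forwarded` that demands an honest supporter rules this out.
    exact (hc v hv).1 hv'
  · exact fun h => ⟨E.honest lam, fun v hv => by simp [h, hv],
      E.forwarded_of_honest_subset lam subset_rfl⟩

/-- The quantifier over votes collapses to the honest verdict, so the step that follows `validate`
is the identity on bits. -/
theorem thresholdGame_eq (A : Adversary) (lam : ℕ) :
    E.thresholdGame A lam = E.scheme.referee A (E.size lam) lam false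
      (fun o c => Admissible o ∧ o.state.challenge = none ∧ #(o.involved c.msg) < E.threshold lam)
      (E.validate lam) := by
  unfold thresholdGame
  congr 1
  funext o c
  refine Eq.trans ?_ (ROComp.bind_pure _)
  change ROComp.bind _ _ = _
  congr 1
  funext b
  simp [exists_forwarded_iff]

/-- An attack on the threshold produces either at least two unlinked endorsements, or a single one
without the support of any endorser, which is a forgery. -/
theorem winProb_thresholdGame_le (A : Adversary) (lam : ℕ) :
    winProb (E.thresholdGame A lam) ≤
      winProb (E.scheme.linkabilityGame A (E.size lam) lam) +
        winProb (E.scheme.unforgeabilityGame A (E.size lam) lam) := by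
  rw [thresholdGame_eq]
  -- All three games run the same attack with secret bit `false`, so it suffices to compare them for
  -- a fixed outcome `o`.
  refine winProb_le_add (PMF.bind_apply_le_add _ fun o => ?_)
  rcases o.output with _ | d
  · simp
  dsimp only
  generalize decodeClaim (E.size lam) d = c
  split_ifs with hP hL hU hU
  -- Outcomes outside the threshold winning condition contribute `0`. Four cases remain, according
  -- to whether the linkability and the forgery conditions hold.
  all_goals try simp only [PMF.pure_apply, Bool.true_eq_false, if_false, zero_le]
  all_goals
    obtain ⟨-, hch, hlt⟩ := hP
    unfold validate
    split_ifs with hV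
    swap
    · simp [ROComp.run, PMF.pure_map]
    obtain ⟨hring, hlen, hunl⟩ := hV
  -- The linkability condition holds and its check is the same `checkAll`, so that game alone
  -- accounts for the win, whether or not there is also a forgery.
  · exact le_self_add
  · exact le_self_add
  · have hpos := E.threshold_pos lam
    -- With two signatures, the chain involved `< t ≤` length would give the linkability condition.
    -- As `1 ≤ t`, the length is exactly `1`.
    have h1 : ¬ 2 ≤ c.sigs.length := fun h2 => hL ⟨hch, hring, h2, by omega, hunl⟩
    obtain ⟨sig, hsig⟩ := List.length_eq_one_iff.1 (show c.sigs.length = 1 by omega)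
    have heq : E.scheme.checkAll o c = E.scheme.checkHead o c := by
      unfold LRS.checkAll LRS.checkHead
      rw [hsig, LRS.verifyAll_singleton]
    rw [heq]
    exact le_add_self
  -- Impossible case: length at most `1` forces `t = 1`, so nobody is involved, and then every
  -- clause of the forgery condition holds.
  · exfalso
    have hpos := E.threshold_pos lam
    have h1 : ¬ 2 ≤ c.sigs.length := fun h2 => hL ⟨hch, hring, h2, by omega, hunl⟩
    have h0 : o.involved c.msg = ∅ := card_eq_zero.1 (by omega)
    obtain ⟨hcor, hsgn⟩ := union_eq_empty.1 h0
    refine hU ⟨hch, ?_, ?_, fun r hr hM => ?_⟩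
    · rw [hring, card_univ, Fintype.card_fin]
      exact E.two_le lam
    · rw [hcor]
      exact disjoint_empty_right _
    · have hmem : r.signer ∈ (o.state.signed.filterMap fun r =>
          if r.msg = c.msg then some r.signer else none).toFinset :=
        List.mem_toFinset.2 (List.mem_filterMap.2 ⟨r, hr, if_pos hM⟩)
      rw [hsgn] at hmem
      exact notMem_empty _ hmem

/-- Only the threshold bound uses two properties of the scheme, linkability and unforgeability.
Anonymity and framing drop the condition `Admissible`, keeping the same adversary and, for
anonymity, the same `ε`. -/
theorem secure_of_scheme_secure (h : E.scheme.Secure) : E.Secure where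
  threshold A :=
    Negligible.of_le (Asymptotics.SuperpolynomialDecay.add (h.linkable A E.endorsers)
      (h.unforgeable A E.endorsers)) (fun _ => winProb_nonneg _) (E.winProb_thresholdGame_le A)
  anonymity A := by
    obtain ⟨ε, hε, hle⟩ := h.linkablyAnonymous A E.endorsers
    exact ⟨ε, hε, fun lam => (LRS.winProb_guessGame_mono _ A _ lam fun _ ho => ho.2).trans (hle lam)⟩
  framing A :=
    Negligible.of_le (h.nonSlanderable A E.endorsers) (fun _ => winProb_nonneg _)
      fun lam => LRS.winProb_referee_mono _ A _ lam false _ fun _ _ ho => ho.2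
  robust lam _ hc := E.forwarded_of_honest_subset lam fun v hv => (hc v hv).2 trivial

end AES

theorem mainTheorem5 :
    (∀ S : LRS,
      S.Unforgeable → S.LinkablyAnonymous → S.Linkable → S.NonSlanderable →
        S.Secure ∧ ∀ E : AES, E.scheme = S → E.Secure) ∧
    (∀ l μ : ℕ → ℕ,
      (FCsLRS.scheme l μ).Unforgeable → (FCsLRS.scheme l μ).LinkablyAnonymous →
      (FCsLRS.scheme l μ).Linkable → (FCsLRS.scheme l μ).NonSlanderable →
        (FCsLRS.scheme l μ).Secure ∧
          ∀ E : AES, E.scheme = FCsLRS.scheme l μ → E.Secure) := by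
  have key : ∀ S : LRS,
      S.Unforgeable → S.LinkablyAnonymous → S.Linkable → S.NonSlanderable →
        S.Secure ∧ ∀ E : AES, E.scheme = S → E.Secure := by
    intro S hu ha hl hs
    have hS : S.Secure := ⟨hu, ha, hl, hs⟩
    exact ⟨hS, fun E hE => E.secure_of_scheme_secure (hE ▸ hS)⟩
  exact ⟨key, fun l μ => key (FCsLRS.scheme l μ)⟩
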